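/- Let $X,U$ be real Banach spaces, let $(T_t)_{t\in\mathbb R}$ be a $C_0$-group of bounded linear operators on $X$ with infinitesimal generator $A$, let $\mathcal Q$ be a set, and let $f_q:X\times U\to X$ $(q\in\mathcal Q)$ be Lipschitz continuous with a Lipschitz constant $L_f$ independent of $q$ and $f_q(0,0)=0$. Let $K:X\to U$ be globally Lipschitz with $K(0)=0$. Let $\mathrm{PC}$ be the set of piecewise constant $\sigma:\mathbb R_+\to\mathcal Q$, i.e. those constant on each interval $[t_k,t_{k+1})$ for some $0=t_0<t_1<\cdots$ with $t_k\to\infty$. A system that has, for every $x_0\in X$ and $\sigma\in\mathrm{PC}$, a unique trajectory $\phi(\cdot,x_0,\sigma):\mathbb R_+\to X$ with $\phi(0,x_0,\sigma)=x_0$ is called uniformly globally exponentially stable (UGES) if there are $M,\lambda>0$ such that $\|\phi(t,x_0,\sigma)\|\le Me^{-\lambda t}\|x_0\|$ for all $t\ge 0$, $x_0\in X$, $\sigma\in\mathrm{PC}$. Let $\Sigma_0$ be the closed loop $\dot x(t)=Ax(t)+f_{\sigma(t)}(x(t),K(x(t)))$, $x(0)=x_0$; its trajectories are the continuous functions $x:\mathbb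 R_+\to X$ with $x(0)=x_0$ which, on each interval $[a,b)$ on which $\sigma$ is constantly equal to some $q$, satisfy $$x(t)=T_{t-a}x(a)+\int_0^{t-a}T_{t-a-s}f_q\big(x(a+s),K(x(a+s))\big)\,ds .$$ For sampling instants $0=s_0<s_1<s_2<\cdots$ with $s_k\to\infty$, let $\Sigma$ be the predictor-based sampled-data system $\dot x(t)=Ax(t)+f_{\sigma(t)}\big(x(t),K(T_{t-s_k}x(s_k))\big)$, $s_k\le t<s_{k+1}$, $x(0)=x_0$; its trajectories are the continuous functions $x:\mathbb R_+\to X$ with $x(0)=x_0$ such that, for every $k\ge 0$ and $s_k\le t<s_{k+1}$, $$x(t)=T_{t-s_k}x(s_k)+\int_0^{t-s_k}T_{t-s_k-s}f_{\sigma(s+s_k)}\big(x(s+s_k),K(T_sx(s_k))\big)\,ds .$$ Suppose that $\Sigma_0$ is UGES. Then there exists $\delta^\star>0$ such that, for every sequence of sampling instants $(s_k)_{k\ge 0}$ whose maximal sampling time $\sup_{k\ge 0}(s_{k+1}-s_k)$ is smaller than $\delta^\star$, the system $\Sigma$ has a unique trajectory for every $x_0\in X$ and $\sigma\in\mathrm{PC}$,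 and $\Sigma$ is UGES. -/

import Mathlib

open Set Filter Topology MeasureTheory
open scoped NNReal ENNReal

/-- A `C₀`-group `(T t)`, `t ∈ ℝ`, of bounded linear operators on a real Banach space `X`.
Its infinitesimal generator `A` enters the evolution equations below through `T` only, because
their solutions are understood in the mild sense. -/
structure C0Group (X : Type*) [NormedAddCommGroup X] [NormedSpace ℝ X] where
  /-- the operators of the group -/
  toFun : ℝ → X →L[ℝ] X
  map_zero : toFun 0 = ContinuousLinearMap.id ℝ X
  map_add : ∀ s t : ℝ, toFun (s + t) = (toFun s).comp (toFun t)
  strongly_continuous : ∀ x : X, Continuous fun t : ℝ => toFun t x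

instance {X : Type*} [NormedAddCommGroup X] [NormedSpace ℝ X] :
    CoeFun (C0Group X) (fun _ => ℝ → X →L[ℝ] X) := ⟨C0Group.toFun⟩

/-- Piecewise constant switching signals `σ : ℝ₊ → Q`: there are switching times
`0 = t₀ < t₁ < ⋯` with `tₖ → ∞` such that `σ` is constant on every `[tₖ, tₖ₊₁)`.
The domain `ℝ₊` is represented by the nonnegative part of `ℝ`; values at negative times are
never used. -/
def PC (Q : Type*) : Set (ℝ → Q) :=
  {σ | ∃ t : ℕ → ℝ, t 0 = 0 ∧ StrictMono t ∧ Tendsto t atTop atTop ∧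
    ∀ k, ∀ u ∈ Ico (t k) (t (k + 1)), σ u = σ (t k)}

/-- `IsMildOn T g a b x`: on the time interval `[a, b)`, the curve `x` satisfies the
variation-of-constants (mild) form of `x' = A x + g(t, x)` with initial time `a`, where `A`
generates `T`. -/
def IsMildOn {X : Type*} [NormedAddCommGroup X] [NormedSpace ℝ X] (T : C0Group X)
    (g : ℝ → X → X) (a b : ℝ) (x : ℝ → X) : Prop :=
  ∀ t ∈ Ico a b,
    x t = T (t - a) (x a) + ∫ s in (0 : ℝ)..(t - a), T (t - a - s) (g (a + s) (x (a + s)))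

/-- `x : ℝ₊ → X` is the trajectory from `x₀` with switching signal `σ` of the closed loop
`x'(t) = A x(t) + f_{σ(t)}(x(t), K(x(t)))`: it is continuous, and on every interval `[a, b)` on
which `σ` is constantly equal to some `q` it is a mild solution of
`x' = A x + f_q(x, K(x))` (concatenation of the flows of the individual modes). -/
def IsClosedLoopTrajectory {X U Q : Type*} [NormedAddCommGroup X] [NormedSpace ℝ X]
    (T : C0Group X) (f : Q → X × U → X) (K : X → U)
    (x₀ : X) (σ : ℝ → Q) (x : ℝ → X) : Prop :=
  ContinuousOn x (Ici 0) ∧ x 0 = x₀ ∧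
    ∀ (q : Q) (a b : ℝ), 0 ≤ a → (∀ u ∈ Ico a b, σ u = q) →
      IsMildOn T (fun _ z => f q (z, K z)) a b x

/-- Sequences of sampling instants `0 = s₀ < s₁ < ⋯ < sₖ < ⋯` with `sₖ → ∞`. -/
structure IsSamplingSequence (s : ℕ → ℝ) : Prop where
  zero : s 0 = 0
  strictMono : StrictMono s
  tendsto : Tendsto s atTop atTop

/-- The maximal sampling time `sup_{k ≥ 0} (s_{k+1} - s_k)`, as an element of `[0, ∞]`. -/
noncomputable def maxSamplingTime (s : ℕ → ℝ) : ℝ≥0∞ :=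
  ⨆ k, ENNReal.ofReal (s (k + 1) - s k)

/-- `x : ℝ₊ → X` is a solution from `x₀` with switching signal `σ` of the predictor-based
sampled-data system `x'(t) = A x(t) + f_{σ(t)}(x(t), K(T_{t - s_k} x(s_k)))`,
`s_k ≤ t < s_{k+1}`: it is continuous and a mild solution on every sampling interval. -/
def IsSampledTrajectory {X U Q : Type*} [NormedAddCommGroup X] [NormedSpace ℝ X]
    (T : C0Group X) (f : Q → X × U → X) (K : X → U) (s : ℕ → ℝ)
    (x₀ : X) (σ : ℝ → Q) (x : ℝ → X) : Prop :=
  ContinuousOn x (Ici 0) ∧ x 0 = x₀ ∧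
    ∀ k, IsMildOn T (fun t z => f (σ t) (z, K (T (t - s k) (x (s k))))) (s k) (s (k + 1)) x

/-- A system is given by its trajectories: `Traj x₀ σ x` says that `x : ℝ₊ → X` is a trajectory
from `x₀` with signal `σ`. It is well posed if for every `x₀ ∈ X` and `σ ∈ S` there is exactly
one trajectory on `ℝ₊`; then `φ(t, x₀, σ) := x(t)` is its transition map. -/
def WellPosed {X Q : Type*} (S : Set (ℝ → Q)) (Traj : X → (ℝ → Q) → (ℝ → X) → Prop) : Prop :=
  ∀ x₀ : X, ∀ σ ∈ S, ∃ x : ℝ → X, Traj x₀ σ x ∧ ∀ y : ℝ → X, Traj x₀ σ y → EqOn y x (Ici 0)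

/-- Uniform global exponential stability at the origin: there are `M, lam > 0` with
`‖φ(t, x₀, σ)‖ ≤ M exp(-lam t) ‖x₀‖` for all `t ≥ 0`, `x₀ ∈ X`, `σ ∈ S`, where
`φ(·, x₀, σ)` is the trajectory from `x₀` with signal `σ`. -/
def UGES {X Q : Type*} [NormedAddCommGroup X] (S : Set (ℝ → Q))
    (Traj : X → (ℝ → Q) → (ℝ → X) → Prop) : Prop :=
  ∃ M : ℝ, 0 < M ∧ ∃ lam : ℝ, 0 < lam ∧
    ∀ x₀ : X, ∀ σ ∈ S, ∀ x : ℝ → X, Traj x₀ σ x →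
      ∀ t : ℝ, 0 ≤ t → ‖x t‖ ≤ M * Real.exp (-lam * t) * ‖x₀‖

/-! On a bounded time window the sampled system is a small perturbation of the closed loop. The
prediction `T (t - s k) (x (s k))` differs from `x t` only by the forcing accumulated since the last
sample, so its error is at most a multiple of the maximal sampling time `d`. A weighted Gronwall
argument turns this into `‖x t - z t‖ ≤ d * P * ‖x₀‖ * exp (lam * t)`, where `z` is the closed-loop
trajectory with the same data (`exists_norm_predictor_sub_le`).

By UGES of the closed loop, `‖z t‖ ≤ ‖x₀‖ / 4` from some time `a` on. With `d` small, the error on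
`[0, a + 1]` is at most `‖x₀‖ / 4` too, so the sampled trajectory has halved throughout `[a, a +
1]`. As `d ≤ 1`, this window contains a sampling instant, where the system restarts with shifted
data of the same kind; iteration gives exponential decay (`uges_of_halving`).

Both systems are Volterra equations with a causal Lipschitz right-hand side, pulled back to time
zero by the group. Existence is a contraction in an exponentially weighted norm (`exists_volterra`);
uniqueness is the Lipschitz estimate in that weight. -/

/-! ### Bounds and continuity for `C₀`-groups. -/

namespace C0Group

variable {X : Type*} [NormedAddCommGroup X] [NormedSpace ℝ X] (T : C0Group X)

theorem zero_apply (y : X) : T 0 y = y := by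
  rw [T.map_zero]; rfl

theorem apply_apply (s t : ℝ) (y : X) : T s (T t y) = T (s + t) y := by
  rw [T.map_add]; rfl

theorem apply_neg_apply (t : ℝ) (y : X) : T t (T (-t) y) = y := by
  rw [T.apply_apply, add_neg_cancel, T.zero_apply]

theorem neg_apply_apply (t : ℝ) (y : X) : T (-t) (T t y) = y := by
  rw [T.apply_apply, neg_add_cancel, T.zero_apply]

/-- Each operator of a `C₀`-group, as a continuous linear equivalence. -/
noncomputable def equiv (t : ℝ) : X ≃L[ℝ] X :=
  ContinuousLinearEquiv.equivOfInverse (T t) (T (-t)) (T.neg_apply_apply t) (T.apply_neg_apply t)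

/-- Invertibility of `T t` removes any integrability assumption on `F`. -/
theorem apply_intervalIntegral (t a b : ℝ) (F : ℝ → X) :
    T t (∫ r in a..b, F r) = ∫ r in a..b, T t (F r) := by
  have h : ∀ μ : Measure ℝ, ∫ r, T t (F r) ∂μ = T t (∫ r, F r ∂μ) := fun μ =>
    (T.equiv t).integral_comp_comm (𝕜 := ℝ) (μ := μ) F
  simp only [intervalIntegral, h, map_sub]

/-- The right-hand side of the variation-of-constants formula, pulled back to time zero. -/
theorem mild_eq (h : ℝ → X) (a t : ℝ) (y : X) :
    T (t - a) y + ∫ s in (0 : ℝ)..(t - a), T (t - a - s) (h (a + s)) =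
      T t (T (-a) y + ∫ r in a..t, T (-r) (h r)) := by
  rw [(T t).map_add, T.apply_apply, T.apply_intervalIntegral]
  have := intervalIntegral.integral_comp_add_left (a := 0) (b := t - a)
    (fun r => T t (T (-r) (h r))) a
  rw [add_zero, add_sub_cancel] at this
  rw [← this]
  simp only [T.apply_apply, sub_eq_add_neg, neg_add, add_assoc]

variable [CompleteSpace X]

theorem exists_norm_le_on_Icc (a b : ℝ) : ∃ C : ℝ, 0 ≤ C ∧ ∀ t ∈ Icc a b, ‖T t‖ ≤ C := by
  obtain ⟨C, hC⟩ := banach_steinhaus (g := fun t : Icc a b => T t) fun y => by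
    obtain ⟨B, hB⟩ := (isCompact_Icc (a := a) (b := b)).exists_bound_of_continuousOn
      (T.strongly_continuous y).continuousOn
    exact ⟨B, fun t => hB t t.2⟩
  exact ⟨max C 0, le_max_right _ _, fun t ht => (hC ⟨t, ht⟩).trans (le_max_left _ _)⟩

/-- Exponential growth bound of a `C₀`-group on the positive half-line. -/
theorem exists_norm_le_exp :
    ∃ C w : ℝ, 1 ≤ C ∧ 0 ≤ w ∧ ∀ t : ℝ, 0 ≤ t → ‖T t‖ ≤ C * Real.exp (w * t) := by
  obtain ⟨C₀, -, hC₀⟩ := T.exists_norm_le_on_Icc 0 1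
  set C := max C₀ 1
  have hC1 : 1 ≤ C := le_max_right _ _
  have hC : ∀ t ∈ Icc (0 : ℝ) 1, ‖T t‖ ≤ C := fun t ht => (hC₀ t ht).trans (le_max_left _ _)
  have hw : 0 ≤ Real.log C := Real.log_nonneg hC1
  -- With rate `log C`, each unit of time accounts for one factor `C = exp (log C)`.
  refine ⟨C, Real.log C, hC1, hw, ?_⟩
  have key : ∀ n : ℕ, ∀ t : ℝ, 0 ≤ t → t ≤ n → ‖T t‖ ≤ C * Real.exp (Real.log C * t) := by
    intro n
    induction n with
    | zero =>
      intro t h0 ht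
      have : t = 0 := le_antisymm (by simpa using ht) h0
      subst this
      simpa using hC 0 (by simp)
    | succ n ih =>
      intro t h0 ht
      by_cases h1 : t ≤ 1
      · refine (hC t ⟨h0, h1⟩).trans (le_mul_of_one_le_right (by linarith) ?_)
        exact Real.one_le_exp (by positivity)
      · push Not at h1
        have h2 : T t = (T 1).comp (T (t - 1)) := by rw [← T.map_add, add_sub_cancel]
        have h3 := ih (t - 1) (by linarith) (by push_cast at ht; linarith)
        calc ‖T t‖ ≤ ‖T 1‖ * ‖T (t - 1)‖ := h2 ▸ ContinuousLinearMap.opNorm_comp_le _ _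
          _ ≤ C * (C * Real.exp (Real.log C * (t - 1))) := by
            gcongr
            exact hC 1 (by simp)
          _ = C * (Real.exp (Real.log C) * Real.exp (Real.log C * (t - 1))) := by
            rw [Real.exp_log (by linarith)]
          _ = _ := by rw [← Real.exp_add]; ring_nf
  intro t ht
  exact key _ t ht (Nat.le_ceil t)

/-- A `C₀`-group acts jointly continuously. -/
theorem continuous_uncurry : Continuous fun p : ℝ × X => T p.1 p.2 := by
  rw [continuous_iff_continuousAt]
  rintro ⟨t, y⟩
  obtain ⟨C, hC0, hC⟩ := T.exists_norm_le_on_Icc (t - 1) (t + 1)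
  have h1 : Tendsto (fun p : ℝ × X => C * ‖p.2 - y‖ + ‖T p.1 y - T t y‖) (𝓝 (t, y)) (𝓝 0) := by
    have hc : Continuous fun p : ℝ × X => C * ‖p.2 - y‖ + ‖T p.1 y - T t y‖ := by
      have := (T.strongly_continuous y).comp (continuous_fst (X := ℝ) (Y := X))
      have h' : Continuous fun p : ℝ × X => T p.1 y := this
      fun_prop
    simpa using hc.tendsto (t, y)
  rw [ContinuousAt, tendsto_iff_norm_sub_tendsto_zero]
  refine squeeze_zero' (Eventually.of_forall fun _ => norm_nonneg _) ?_ h1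
  have hmem : ∀ᶠ p : ℝ × X in 𝓝 (t, y), p.1 ∈ Icc (t - 1) (t + 1) :=
    continuous_fst.continuousAt.eventually_mem (Icc_mem_nhds (by simp) (by simp))
  filter_upwards [hmem] with p hp
  have : T p.1 p.2 - T t y = T p.1 (p.2 - y) + (T p.1 y - T t y) := by
    rw [map_sub]; abel
  rw [this]
  refine (norm_add_le _ _).trans (add_le_add_left ?_ _)
  exact (T p.1).le_of_opNorm_le (hC _ hp) _

omit [CompleteSpace X] in
/-- Weighted bound for the Duhamel term. -/
theorem norm_duhamel_le {C w lam E t : ℝ} (hT : ∀ t : ℝ, 0 ≤ t → ‖T t‖ ≤ C * Real.exp (w * t))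
    (hC : 0 ≤ C) (hlam : w < lam) (ht : 0 ≤ t) (hE : 0 ≤ E) {h : ℝ → X}
    (hh : ∀ s ∈ Icc 0 t, ‖h s‖ ≤ E * Real.exp (lam * s)) :
    ‖T t (∫ r in (0 : ℝ)..t, T (-r) (h r))‖ ≤ C * E / (lam - w) * Real.exp (lam * t) := by
  have hpos : 0 < lam - w := sub_pos.2 hlam
  rw [T.apply_intervalIntegral]
  have hint : ∀ r ∈ Ioc 0 t, ‖T t (T (-r) (h r))‖ ≤
      C * E * Real.exp (w * t) * Real.exp ((lam - w) * r) := by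
    intro r hr
    rw [T.apply_apply]
    calc ‖T (t + -r) (h r)‖ ≤ (C * Real.exp (w * (t + -r))) * (E * Real.exp (lam * r)) :=
          (T _).le_of_opNorm_le_of_le (hT _ (by linarith [hr.2])) (hh r ⟨hr.1.le, hr.2⟩)
      _ = C * E * (Real.exp (w * (t + -r)) * Real.exp (lam * r)) := by ring
      _ = C * E * (Real.exp (w * t) * Real.exp ((lam - w) * r)) := by
        rw [← Real.exp_add, ← Real.exp_add]; ring_nf
      _ = _ := by ring
  refine (intervalIntegral.norm_integral_le_of_norm_le ht (Eventually.of_forall hint)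
    (by apply Continuous.intervalIntegrable; fun_prop)).trans ?_
  have hI : ∫ r in (0 : ℝ)..t, Real.exp ((lam - w) * r) =
      Real.exp ((lam - w) * t) / (lam - w) - 1 / (lam - w) := by
    have hd : ∀ r ∈ uIcc 0 t, HasDerivAt (fun r => Real.exp ((lam - w) * r) / (lam - w))
        (Real.exp ((lam - w) * r)) r := by
      intro r _
      have h1 : HasDerivAt (fun r : ℝ => (lam - w) * r) (lam - w) r := by
        simpa using (hasDerivAt_id r).const_mul (lam - w)
      have h2 := h1.exp.div_const (lam - w)
      rwa [mul_div_cancel_right₀ _ hpos.ne'] at h2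
    rw [intervalIntegral.integral_eq_sub_of_hasDerivAt hd
      (by apply Continuous.intervalIntegrable; fun_prop)]
    simp
  rw [intervalIntegral.integral_const_mul, hI]
  calc C * E * Real.exp (w * t) * (Real.exp ((lam - w) * t) / (lam - w) - 1 / (lam - w))
      ≤ C * E * Real.exp (w * t) * (Real.exp ((lam - w) * t) / (lam - w)) := by
        gcongr
        have : 0 ≤ 1 / (lam - w) := by positivity
        linarith
    _ = C * E / (lam - w) * (Real.exp (w * t) * Real.exp ((lam - w) * t)) := by ring
    _ = _ := by rw [← Real.exp_add]; ring_nf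

end C0Group

/-! ### Weighted estimates and causal Volterra equations. -/

/-- If bounds by `D * exp (lam * t)` on `[0, N]` improve to `(D / 2 + e) * exp (lam * t)`, then
the bound `2 * e * exp (lam * t)` holds. -/
theorem norm_le_of_weighted_improvement {X : Type*} [NormedAddCommGroup X] {u : ℝ → X}
    {lam e N : ℝ} (hu : ContinuousOn u (Icc 0 N))
    (himp : ∀ D : ℝ, 0 ≤ D → (∀ t ∈ Icc 0 N, ‖u t‖ ≤ D * Real.exp (lam * t)) →
      ∀ t ∈ Icc 0 N, ‖u t‖ ≤ (D / 2 + e) * Real.exp (lam * t)) :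
    ∀ t ∈ Icc 0 N, ‖u t‖ ≤ 2 * e * Real.exp (lam * t) := by
  intro t ht
  -- The maximal weighted norm `D` is itself an admissible bound, so the improvement gives `D ≤ D /
  -- 2 + e`.
  obtain ⟨m, hm, hmax⟩ := isCompact_Icc.exists_isMaxOn ⟨t, ht⟩
    (f := fun t => ‖u t‖ / Real.exp (lam * t))
    (hu.norm.div (by fun_prop) fun _ _ => (Real.exp_pos _).ne')
  set D := ‖u m‖ / Real.exp (lam * m)
  have hD : ∀ t ∈ Icc 0 N, ‖u t‖ ≤ D * Real.exp (lam * t) := fun r hr =>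
    (div_le_iff₀ (Real.exp_pos _)).1 (hmax hr)
  have h1 : D ≤ D / 2 + e :=
    (div_le_iff₀ (Real.exp_pos _)).2 (himp D (by positivity) hD m hm)
  refine (hD t ht).trans ?_
  gcongr
  linarith

theorem continuousOn_primitive_Ici {X : Type*} [NormedAddCommGroup X] [NormedSpace ℝ X]
    {F : ℝ → X} (hF : ∀ t : ℝ, 0 ≤ t → IntervalIntegrable F volume 0 t) :
    ContinuousOn (fun t => ∫ r in (0 : ℝ)..t, F r) (Ici 0) := by
  intro t ht
  have h0 : (0 : ℝ) ≤ t + 1 := by linarith [mem_Ici.1 ht]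
  have h1 : IntegrableOn F (uIcc 0 (t + 1)) := by
    rw [uIcc_of_le h0]
    exact (intervalIntegrable_iff_integrableOn_Icc_of_le h0).1 (hF _ h0)
  have h2 := intervalIntegral.continuousOn_primitive_interval h1
  rw [uIcc_of_le h0] at h2
  refine (h2 t ⟨ht, by linarith⟩).mono_of_mem_nhdsWithin ?_
  have : Ici (0 : ℝ) ∩ Iio (t + 1) ⊆ Icc 0 (t + 1) := fun r hr => ⟨hr.1, hr.2.le⟩
  exact mem_of_superset (inter_mem self_mem_nhdsWithin
    (mem_nhdsWithin_of_mem_nhds (Iio_mem_nhds (by linarith)))) this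

/-- A causal right-hand side `G s x`, depending on the restriction of the path `x` to `[0, s]`
in a globally Lipschitz way, vanishing at the zero path. -/
structure IsCausalLipschitz {X : Type*} [NormedAddCommGroup X] (G : ℝ → (ℝ → X) → X) (L : ℝ) :
    Prop where
  meas : ∀ x : ℝ → X, ContinuousOn x (Ici 0) →
    AEStronglyMeasurable (fun s => G s x) (volume.restrict (Ici 0))
  lip : ∀ s : ℝ, 0 ≤ s → ∀ (x y : ℝ → X) (B : ℝ), (∀ r ∈ Icc 0 s, ‖x r - y r‖ ≤ B) →
    ‖G s x - G s y‖ ≤ L * B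
  zero : ∀ s : ℝ, 0 ≤ s → G s (fun _ => 0) = 0

/-- Mild solutions on `[0, ∞)` of `x' = A x + h`, pulled back by the group. -/
def IsVolterraSolution {X : Type*} [NormedAddCommGroup X] [NormedSpace ℝ X] (T : C0Group X)
    (h : ℝ → X) (x₀ : X) (x : ℝ → X) : Prop :=
  ∀ t : ℝ, 0 ≤ t → x t = T t (x₀ + ∫ r in (0 : ℝ)..t, T (-r) (h r))

namespace IsCausalLipschitz

variable {X : Type*} [NormedAddCommGroup X] {G : ℝ → (ℝ → X) → X} {L : ℝ}

theorem norm_le (hG : IsCausalLipschitz G L) {s B : ℝ} (hs : 0 ≤ s) {x : ℝ → X}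
    (hx : ∀ r ∈ Icc 0 s, ‖x r‖ ≤ B) : ‖G s x‖ ≤ L * B := by
  simpa [hG.zero s hs] using hG.lip s hs x (fun _ => 0) B (by simpa using hx)

theorem lip_exp (hG : IsCausalLipschitz G L) {lam D s : ℝ} (hlam : 0 ≤ lam) (hD : 0 ≤ D)
    (hs : 0 ≤ s) {x y : ℝ → X} (h : ∀ r ∈ Icc 0 s, ‖x r - y r‖ ≤ D * Real.exp (lam * r)) :
    ‖G s x - G s y‖ ≤ L * D * Real.exp (lam * s) := by
  rw [mul_assoc]
  refine hG.lip s hs x y _ fun r hr => (h r hr).trans ?_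
  gcongr
  exact hr.2

variable [NormedSpace ℝ X] [CompleteSpace X]

theorem intervalIntegrable (hG : IsCausalLipschitz G L) (T : C0Group X) {x : ℝ → X}
    (hx : ContinuousOn x (Ici 0)) {t : ℝ} (ht : 0 ≤ t) :
    IntervalIntegrable (fun r => T (-r) (G r x)) volume 0 t := by
  obtain ⟨B, hB⟩ := isCompact_Icc.exists_bound_of_continuousOn
    (hx.mono (Icc_subset_Ici_self : Icc 0 t ⊆ Ici 0))
  obtain ⟨C, hC0, hC⟩ := T.exists_norm_le_on_Icc (-t) 0
  rw [intervalIntegrable_iff_integrableOn_Icc_of_le ht]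
  have hm : AEStronglyMeasurable (fun r => T (-r) (G r x)) (volume.restrict (Icc 0 t)) := by
    have h1 := (hG.meas x hx).mono_measure (Measure.restrict_mono_set volume
      (Icc_subset_Ici_self : Icc 0 t ⊆ Ici 0))
    have h2 : AEStronglyMeasurable (fun r : ℝ => -r) (volume.restrict (Icc 0 t)) :=
      continuous_neg.aestronglyMeasurable
    exact T.continuous_uncurry.comp_aestronglyMeasurable (h2.prodMk h1)
  refine IntegrableOn.of_bound (by simp) hm (C * (L * B)) ?_
  filter_upwards [ae_restrict_mem measurableSet_Icc] with r hr
  refine (T _).le_of_opNorm_le_of_le (hC _ ⟨by linarith [hr.2], by linarith [hr.1]⟩) ?_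
  exact hG.norm_le hr.1 fun q hq => hB q ⟨hq.1, hq.2.trans hr.2⟩

theorem continuousOn_volterra (hG : IsCausalLipschitz G L) (T : C0Group X) (x₀ : X) {x : ℝ → X}
    (hx : ContinuousOn x (Ici 0)) :
    ContinuousOn (fun t => T t (x₀ + ∫ r in (0 : ℝ)..t, T (-r) (G r x))) (Ici 0) :=
  T.continuous_uncurry.comp_continuousOn (continuousOn_id.prodMk
    (continuousOn_const.add (continuousOn_primitive_Ici fun _ ht => hG.intervalIntegrable T hx ht)))

theorem volterra_sub (hG : IsCausalLipschitz G L) {G' : ℝ → (ℝ → X) → X} {L' : ℝ}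
    (hG' : IsCausalLipschitz G' L') {T : C0Group X} {x₀ y₀ : X} {x y : ℝ → X}
    (hx : ContinuousOn x (Ici 0)) (hy : ContinuousOn y (Ici 0))
    {t : ℝ} (ht : 0 ≤ t) :
    T t (x₀ + ∫ r in (0 : ℝ)..t, T (-r) (G r x)) - T t (y₀ + ∫ r in (0 : ℝ)..t, T (-r) (G' r y)) =
      T t (x₀ - y₀) + T t (∫ r in (0 : ℝ)..t, T (-r) (G r x - G' r y)) := by
  simp only [map_sub]
  rw [intervalIntegral.integral_sub (hG.intervalIntegrable T hx ht)
    (hG'.intervalIntegrable T hy ht)]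
  simp only [map_add, map_sub]
  abel

/-- Global existence for causal Lipschitz perturbations of a `C₀`-group. -/
theorem exists_volterra (hG : IsCausalLipschitz G L) (hL : 0 < L) (T : C0Group X) (x₀ : X) :
    ∃ x : ℝ → X, ContinuousOn x (Ici 0) ∧ IsVolterraSolution T (fun s => G s x) x₀ x := by
  obtain ⟨C, w, hC, hw, hT⟩ := T.exists_norm_le_exp
  have hC0 : 0 < C := by linarith
  -- This weight makes the Duhamel factor `C * L / (lam - w)` equal to `1 / 2`.
  set lam := w + 2 * (C * L)
  have hlw : w < lam := by have := mul_pos hC0 hL; simp only [lam]; linarith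
  have hlam : 0 ≤ lam := by linarith
  have hhalf : ∀ E : ℝ, C * (L * E) / (lam - w) = E / 2 := by
    intro E
    simp only [lam]
    field_simp
    ring
  -- The unknown is the bounded function `z`; the path itself may grow like `exp (lam * s)`.
  let path : BoundedContinuousFunction ℝ X → ℝ → X := fun z s => Real.exp (lam * s) • z s
  have hpath : ∀ z, ContinuousOn (path z) (Ici 0) := fun z => by
    have hz := z.continuous
    exact Continuous.continuousOn (by fun_prop)
  let V : BoundedContinuousFunction ℝ X → ℝ → X := fun z t =>
    T t (x₀ + ∫ r in (0 : ℝ)..t, T (-r) (G r (path z)))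
  -- Truncation at `max t 0` extends the map constantly to negative times, so the fixed point is
  -- sought among bounded continuous functions on all of `ℝ`.
  let W : BoundedContinuousFunction ℝ X → ℝ → X := fun z t =>
    Real.exp (-(lam * max t 0)) • V z (max t 0)
  have hWc : ∀ z, Continuous (W z) := fun z => by
    have h1 : Continuous fun t : ℝ => V z (max t 0) :=
      (hG.continuousOn_volterra T x₀ (hpath z)).comp_continuous
        (continuous_id.max continuous_const) fun t => le_max_right t 0
    exact Continuous.smul (by fun_prop) h1
  have hscale : ∀ (a : ℝ) (v : X) (B : ℝ), ‖v‖ ≤ B * Real.exp (lam * a) →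
      ‖Real.exp (-(lam * a)) • v‖ ≤ B := by
    intro a v B h
    rw [norm_smul, Real.norm_eq_abs, abs_of_pos (Real.exp_pos _), Real.exp_neg,
      inv_mul_le_iff₀ (Real.exp_pos _), mul_comm]
    exact h
  have hdist : ∀ z z' : BoundedContinuousFunction ℝ X, ∀ r : ℝ,
      ‖path z r - path z' r‖ ≤ ‖z - z'‖ * Real.exp (lam * r) := by
    intro z z' r
    simp only [path]
    rw [← smul_sub, norm_smul, Real.norm_eq_abs, abs_of_pos (Real.exp_pos _), mul_comm]
    gcongr
    exact (z - z').norm_coe_le_norm r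
  have hVsub : ∀ z z' : BoundedContinuousFunction ℝ X, ∀ t : ℝ, 0 ≤ t →
      ‖V z t - V z' t‖ ≤ ‖z - z'‖ / 2 * Real.exp (lam * t) := by
    intro z z' t ht
    simp only [V]
    rw [hG.volterra_sub hG (hpath z) (hpath z') ht, sub_self, map_zero, zero_add, ← hhalf]
    refine T.norm_duhamel_le hT hC0.le hlw ht (by positivity) fun s hs => ?_
    exact hG.lip_exp hlam (norm_nonneg _) hs.1 fun r _ => hdist z z' r
  have hWsub : ∀ z z' : BoundedContinuousFunction ℝ X, ∀ t : ℝ,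
      ‖W z t - W z' t‖ ≤ ‖z - z'‖ / 2 := by
    intro z z' t
    simp only [W]
    rw [← smul_sub]
    exact hscale _ _ _ (hVsub z z' _ (le_max_right _ _))
  have hW0 : ∀ t, ‖W 0 t‖ ≤ C * ‖x₀‖ := by
    intro t
    refine hscale _ _ _ ?_
    have ht : 0 ≤ max t 0 := le_max_right _ _
    have h0 : path 0 = fun _ => 0 := by ext r; simp [path]
    have h1 : V 0 (max t 0) = T (max t 0) x₀ := by
      have h2 : ∫ r in (0 : ℝ)..(max t 0), T (-r) (G r (path 0)) = ∫ r in (0 : ℝ)..(max t 0), 0 := by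
        refine intervalIntegral.integral_congr fun r hr => ?_
        rw [uIcc_of_le ht] at hr
        simp only [h0, hG.zero r hr.1, map_zero]
      simp only [V]
      rw [h2, intervalIntegral.integral_zero, add_zero]
    rw [h1]
    refine ((T _).le_of_opNorm_le (hT _ ht) x₀).trans ?_
    rw [mul_right_comm]
    gcongr
  have hWb : ∀ z t, ‖W z t‖ ≤ ‖z‖ / 2 + C * ‖x₀‖ := by
    intro z t
    have h1 := hWsub z 0 t
    rw [sub_zero] at h1
    have h2 := norm_add_le (W z t - W 0 t) (W 0 t)
    rw [sub_add_cancel] at h2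
    linarith [hW0 t]
  let Φ : BoundedContinuousFunction ℝ X → BoundedContinuousFunction ℝ X := fun z =>
    BoundedContinuousFunction.ofNormedAddCommGroup (W z) (hWc z) _ (hWb z)
  have hΦ : ContractingWith (1 / 2 : ℝ≥0) Φ := by
    refine ⟨by rw [← NNReal.coe_lt_coe]; norm_num, LipschitzWith.of_dist_le_mul fun z z' => ?_⟩
    rw [dist_eq_norm, dist_eq_norm]
    have : ((1 / 2 : ℝ≥0) : ℝ) * ‖z - z'‖ = ‖z - z'‖ / 2 := by push_cast; ring
    rw [this]
    exact (BoundedContinuousFunction.norm_le (by positivity)).2 fun t => hWsub z z' t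
  set z := ContractingWith.fixedPoint Φ hΦ
  have hz : Φ z = z := ContractingWith.fixedPoint_isFixedPt hΦ
  refine ⟨path z, hpath z, fun t ht => ?_⟩
  have h1 : z t = W z t := by
    conv_lhs => rw [← hz]
    rfl
  simp only [path] at h1 ⊢
  rw [h1]
  simp only [W, max_eq_left ht]
  rw [smul_smul, ← Real.exp_add, add_neg_cancel, Real.exp_zero, one_smul]

end IsCausalLipschitz

/-! ### Sampling sequences and lags. -/

theorem IsSamplingSequence.iUnion_Ico {s : ℕ → ℝ} (hs : IsSamplingSequence s) :
    ⋃ k, Ico (s k) (s (k + 1)) = Ici 0 := by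
  have h := iUnion_Ico_map_succ_eq_Ici (f := s) (fun k => hs.strictMono.monotone (Nat.zero_le k))
    (not_bddAbove_of_tendsto_atTop hs.tendsto)
  simpa [hs.zero] using h

theorem IsSamplingSequence.exists_mem_Ico {s : ℕ → ℝ} (hs : IsSamplingSequence s) {r : ℝ}
    (hr : 0 ≤ r) : ∃ k, r ∈ Ico (s k) (s (k + 1)) := by
  have h : r ∈ ⋃ k, Ico (s k) (s (k + 1)) := hs.iUnion_Ico ▸ hr
  simpa only [mem_iUnion] using h

theorem IsSamplingSequence.nonneg {s : ℕ → ℝ} (hs : IsSamplingSequence s) (k : ℕ) : 0 ≤ s k :=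
  hs.zero ▸ hs.strictMono.monotone (Nat.zero_le k)

theorem StrictMono.Ico_index_unique {s : ℕ → ℝ} (hs : StrictMono s) {r : ℝ} {j k : ℕ}
    (hj : r ∈ Ico (s j) (s (j + 1))) (hk : r ∈ Ico (s k) (s (k + 1))) : j = k := by
  have h1 := hs.lt_iff_lt.1 (hj.1.trans_lt hk.2)
  have h2 := hs.lt_iff_lt.1 (hk.1.trans_lt hj.2)
  omega

open Classical in
/-- The last sampling instant before time `r`. -/
noncomputable def lastSample (s : ℕ → ℝ) (r : ℝ) : ℝ :=
  -- For a sampling sequence, the default value `r` occurs only at negative times.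
  if h : ∃ k, r ∈ Ico (s k) (s (k + 1)) then s h.choose else r

theorem lastSample_eq {s : ℕ → ℝ} (hs : StrictMono s) {r : ℝ} {k : ℕ}
    (hk : r ∈ Ico (s k) (s (k + 1))) : lastSample s r = s k := by
  have h : ∃ k, r ∈ Ico (s k) (s (k + 1)) := ⟨k, hk⟩
  rw [lastSample, dif_pos h, hs.Ico_index_unique h.choose_spec hk]

/-- `l r` is an earlier time, depending piecewise continuously on `r ≥ 0`, with lag at most `d`. -/
structure IsLag (s : ℕ → ℝ) (d : ℝ) (l : ℝ → ℝ) : Prop where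
  nonneg : ∀ r : ℝ, 0 ≤ r → 0 ≤ l r
  le : ∀ r : ℝ, 0 ≤ r → l r ≤ r
  lag : ∀ r : ℝ, 0 ≤ r → r - l r ≤ d
  cont : ∀ k, ContinuousOn l (Ico (s k) (s (k + 1)))

/-- With zero lag the predictor feedback is the exact feedback, so the closed loop falls under the
same framework as the sampled system. -/
theorem isLag_id (s : ℕ → ℝ) {d : ℝ} (hd : 0 ≤ d) : IsLag s d id :=
  ⟨fun _ h => h, fun _ _ => le_rfl, fun _ _ => by simpa using hd, fun _ => continuousOn_id⟩

theorem isLag_lastSample {s : ℕ → ℝ} (hs : IsSamplingSequence s) {d : ℝ}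
    (hd : ∀ k, s (k + 1) - s k ≤ d) : IsLag s d (lastSample s) := by
  refine ⟨fun r hr => ?_, fun r hr => ?_, fun r hr => ?_, fun k => ?_⟩
  iterate 3
    obtain ⟨k, hk⟩ := hs.exists_mem_Ico hr
    rw [lastSample_eq hs.strictMono hk]
    linarith [hk.1, hk.2, hd k, hs.nonneg k]
  exact continuousOn_const.congr fun r hr => lastSample_eq hs.strictMono hr

/-! ### The predictor feedback as a causal Lipschitz right-hand side. -/

section Feedback

variable {X U Q : Type*} [NormedAddCommGroup X] [NormedSpace ℝ X]

/-- The switched vector field with predictor feedback computed from the state at time `l r`. -/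
def predictorField (T : C0Group X) (f : Q → X × U → X) (K : X → U) (σ : ℝ → Q) (l : ℝ → ℝ)
    (r : ℝ) (x : ℝ → X) : X :=
  f (σ r) (x r, K (T (r - l r) (x (l r))))

theorem predictorField_id (T : C0Group X) (f : Q → X × U → X) (K : X → U) (σ : ℝ → Q)
    (r : ℝ) (x : ℝ → X) : predictorField T f K σ id r x = f (σ r) (x r, K (x r)) := by
  simp [predictorField, T.zero_apply]

variable [NormedAddCommGroup U] {T : C0Group X} {f : Q → X × U → X} {Lf : ℝ≥0} {K : X → U}
  {LK : ℝ≥0}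

omit [NormedSpace ℝ X] in
theorem norm_field_sub_le (hf : ∀ q, LipschitzWith Lf (f q)) (hK : LipschitzWith LK K) (q : Q)
    {a b c d : X} {A B : ℝ} (h₁ : ‖a - b‖ ≤ A) (h₂ : ‖c - d‖ ≤ B) :
    ‖f q (a, K c) - f q (b, K d)‖ ≤ Lf * (A + LK * B) := by
  have hA : 0 ≤ A := (norm_nonneg _).trans h₁
  have hB : 0 ≤ B := (norm_nonneg _).trans h₂
  have h3 : ‖K c - K d‖ ≤ LK * B := (hK.norm_sub_le c d).trans (by gcongr)
  refine ((hf q).norm_sub_le _ _).trans ?_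
  gcongr
  rw [Prod.mk_sub_mk, Prod.norm_mk]
  have := mul_nonneg LK.coe_nonneg hB
  exact max_le (by linarith) (by linarith)

/-- On each intersection of a switching interval with a sampling interval the field is continuous in
time, and countably many of these cover `[0, ∞)`; this gives measurability. The Lipschitz constant
is uniform because the prediction horizon `r - l r` stays in `[0, d]`. -/
theorem isCausalLipschitz_predictorField [CompleteSpace X] (hf : ∀ q, LipschitzWith Lf (f q))
    (hf0 : ∀ q, f q (0, 0) = 0) (hK : LipschitzWith LK K) (hK0 : K 0 = 0)
    {σ : ℝ → Q} (hσ : σ ∈ PC Q) {s : ℕ → ℝ} (hs : IsSamplingSequence s)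
    {l : ℝ → ℝ} {d : ℝ} (hl : IsLag s d l) {C L : ℝ} (hC : ∀ t ∈ Icc 0 d, ‖T t‖ ≤ C)
    (hL : Lf * (1 + LK * C) ≤ L) : IsCausalLipschitz (predictorField T f K σ l) L := by
  refine ⟨fun x hx => ?_, fun r hr x y B h => ?_, fun r _ => ?_⟩
  · obtain ⟨τ, hτ0, hτm, hτt, hτ⟩ := hσ
    have hτs : IsSamplingSequence τ := ⟨hτ0, hτm, hτt⟩
    have hU : Ici (0 : ℝ) =
        ⋃ p : ℕ × ℕ, Ico (τ p.1) (τ (p.1 + 1)) ∩ Ico (s p.2) (s (p.2 + 1)) := by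
      ext r
      simp only [mem_inter_iff, mem_iUnion, Prod.exists]
      constructor
      · intro hr
        obtain ⟨j, hj⟩ := hτs.exists_mem_Ico hr
        obtain ⟨k, hk⟩ := hs.exists_mem_Ico hr
        exact ⟨j, k, hj, hk⟩
      · rintro ⟨j, k, hj, -⟩
        exact (hτs.nonneg j).trans hj.1
    rw [hU, aestronglyMeasurable_iUnion_iff]
    rintro ⟨j, k⟩
    set I := Ico (τ j) (τ (j + 1)) ∩ Ico (s k) (s (k + 1))
    have h0 : ∀ r ∈ I, 0 ≤ r := fun r hr => (hs.nonneg k).trans hr.2.1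
    have hlc : ContinuousOn l I := (hl.cont k).mono inter_subset_right
    have hxl : ContinuousOn (fun r => x (l r)) I :=
      hx.comp hlc fun r hr => hl.nonneg r (h0 r hr)
    have hTx : ContinuousOn (fun r => T (r - l r) (x (l r))) I :=
      T.continuous_uncurry.comp_continuousOn ((continuousOn_id.sub hlc).prodMk hxl)
    have hc : ContinuousOn (fun r => f (σ (τ j)) (x r, K (T (r - l r) (x (l r))))) I :=
      (hf _).continuous.comp_continuousOn
        ((hx.mono h0).prodMk (hK.continuous.comp_continuousOn hTx))
    have hc' : ContinuousOn (fun r => predictorField T f K σ l r x) I :=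
      hc.congr fun r hr => by simp only [predictorField, hτ j r hr.1]
    exact hc'.aestronglyMeasurable (measurableSet_Ico.inter measurableSet_Ico)
  · have hB : 0 ≤ B := (norm_nonneg _).trans (h 0 (by simp [hr]))
    have h1 : ‖T (r - l r) (x (l r)) - T (r - l r) (y (l r))‖ ≤ C * B := by
      rw [← map_sub]
      exact (T _).le_of_opNorm_le_of_le
        (hC _ ⟨sub_nonneg.2 (hl.le r hr), hl.lag r hr⟩) (h _ ⟨hl.nonneg r hr, hl.le r hr⟩)
    refine (norm_field_sub_le hf hK (σ r) (h r (by simp [hr])) h1).trans ?_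
    calc Lf * (B + LK * (C * B)) = Lf * (1 + LK * C) * B := by ring
      _ ≤ L * B := by gcongr
  · simp [predictorField, hK0, hf0]

end Feedback

/-! ### Mild solutions on intervals versus the global Volterra equation. -/

section Trajectories

variable {X : Type*} [NormedAddCommGroup X] [NormedSpace ℝ X] [CompleteSpace X]

/-- Pulling `x a` back by `T (-a)` recovers `x₀` plus the integral over `[0, a]`, and integrals over
adjacent intervals add. -/
theorem IsCausalLipschitz.mild_of_volterra {G : ℝ → (ℝ → X) → X} {L : ℝ}
    (hG : IsCausalLipschitz G L) {T : C0Group X} {x₀ : X} {x : ℝ → X}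
    (hx : ContinuousOn x (Ici 0)) (hV : IsVolterraSolution T (fun r => G r x) x₀ x)
    {g : ℝ → X → X} {a b : ℝ} (ha : 0 ≤ a) (hg : ∀ r ∈ Ico a b, G r x = g r (x r)) :
    IsMildOn T g a b x := by
  intro t ht
  have ht0 : 0 ≤ t := ha.trans ht.1
  rw [T.mild_eq (fun r => g r (x r)), hV t ht0]
  congr 1
  have h1 : ∫ r in a..t, T (-r) (g r (x r)) = ∫ r in a..t, T (-r) (G r x) := by
    refine intervalIntegral.integral_congr fun r hr => ?_
    rw [uIcc_of_le ht.1] at hr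
    simp only [hg r ⟨hr.1, hr.2.trans_lt ht.2⟩]
  rw [h1, hV a ha, T.neg_apply_apply, add_assoc,
    ← intervalIntegral.integral_interval_sub_left (hG.intervalIntegrable T hx ht0)
      (hG.intervalIntegrable T hx ha), add_sub_cancel]

theorem IsCausalLipschitz.volterra_of_mild {G : ℝ → (ℝ → X) → X} {L : ℝ}
    (hG : IsCausalLipschitz G L) {T : C0Group X} {x₀ : X} {x : ℝ → X}
    (hx : ContinuousOn x (Ici 0)) (hx0 : x 0 = x₀) {s : ℕ → ℝ} (hs : IsSamplingSequence s)
    {g : ℕ → ℝ → X → X} (hg : ∀ k, ∀ r ∈ Ico (s k) (s (k + 1)), G r x = g k r (x r))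
    (hmild : ∀ k, IsMildOn T (g k) (s k) (s (k + 1)) x) :
    IsVolterraSolution T (fun r => G r x) x₀ x := by
  set V : ℝ → X := fun t => T t (x₀ + ∫ r in (0 : ℝ)..t, T (-r) (G r x))
  have key : ∀ k, EqOn x V (Icc 0 (s k)) := by
    intro k
    induction k with
    | zero =>
      intro t ht
      have : t = 0 := le_antisymm (hs.zero ▸ ht.2) ht.1
      subst this
      simp [V, hx0, T.zero_apply]
    | succ k ih =>
      have hk0 := hs.nonneg k
      have hlt := hs.strictMono (Nat.lt_succ_self k)
      have h1 : EqOn x V (Ico 0 (s (k + 1))) := by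
        intro t ht
        by_cases htk : t ≤ s k
        · exact ih ⟨ht.1, htk⟩
        · have htk' : t ∈ Ico (s k) (s (k + 1)) := ⟨(not_le.1 htk).le, ht.2⟩
          rw [hmild k t htk', T.mild_eq (fun r => g k r (x r)), ih ⟨hk0, le_rfl⟩]
          have h2 : ∫ r in (s k)..t, T (-r) (g k r (x r)) = ∫ r in (s k)..t, T (-r) (G r x) := by
            refine intervalIntegral.integral_congr fun r hr => ?_
            rw [uIcc_of_le htk'.1] at hr
            simp only [hg k r ⟨hr.1, hr.2.trans_lt ht.2⟩]
          simp only [V]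
          rw [h2, T.neg_apply_apply, add_assoc,
            ← intervalIntegral.integral_interval_sub_left (hG.intervalIntegrable T hx ht.1)
              (hG.intervalIntegrable T hx hk0), add_sub_cancel]
      -- The mild formula holds on half-open intervals only; continuity of both sides supplies the
      -- endpoint `s (k + 1)`, from which the next interval starts.
      refine h1.of_subset_closure (hx.mono Icc_subset_Ici_self)
        ((hG.continuousOn_volterra T x₀ hx).mono Icc_subset_Ici_self) Ico_subset_Icc_self ?_
      rw [closure_Ico (hk0.trans_lt hlt).ne]
  intro t ht
  obtain ⟨k, hk⟩ := hs.exists_mem_Ico ht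
  exact key (k + 1) ⟨ht, hk.2.le⟩

variable {U Q : Type*} {T : C0Group X} {f : Q → X × U → X} {K : X → U}

/-- This direction suffices: the stability hypothesis bounds every closed-loop trajectory, and it is
applied to one built as a Volterra solution. -/
theorem isClosedLoopTrajectory_of_volterra {x₀ : X} {σ : ℝ → Q} {L : ℝ} {x : ℝ → X}
    (hG : IsCausalLipschitz (predictorField T f K σ id) L) (hx : ContinuousOn x (Ici 0))
    (hV : IsVolterraSolution T (fun r => predictorField T f K σ id r x) x₀ x) :
    IsClosedLoopTrajectory T f K x₀ σ x := by
  refine ⟨hx, by simpa [T.zero_apply] using hV 0 le_rfl, fun q a b ha hq => ?_⟩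
  exact hG.mild_of_volterra hx hV ha fun r hr => by rw [predictorField_id, hq r hr]

theorem isSampledTrajectory_iff {x₀ : X} {σ : ℝ → Q} {L : ℝ} {x : ℝ → X} {s : ℕ → ℝ}
    (hs : IsSamplingSequence s) (hG : IsCausalLipschitz (predictorField T f K σ (lastSample s)) L) :
    IsSampledTrajectory T f K s x₀ σ x ↔ ContinuousOn x (Ici 0) ∧
      IsVolterraSolution T (fun r => predictorField T f K σ (lastSample s) r x) x₀ x := by
  have hg : ∀ k, ∀ r ∈ Ico (s k) (s (k + 1)), predictorField T f K σ (lastSample s) r x =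
      (fun t z => f (σ t) (z, K (T (t - s k) (x (s k))))) r (x r) := fun k r hr => by
    simp only [predictorField, lastSample_eq hs.strictMono hr]
  constructor
  · rintro ⟨hx, hx0, hmild⟩
    exact ⟨hx, hG.volterra_of_mild hx hx0 hs hg hmild⟩
  · rintro ⟨hx, hV⟩
    exact ⟨hx, by simpa [T.zero_apply] using hV 0 le_rfl, fun k =>
      hG.mild_of_volterra hx hV (hs.nonneg k) (hg k)⟩

end Trajectories

/-! ### Restarting at a later time. -/

section Shift

variable {X U Q : Type*} [NormedAddCommGroup X] [NormedSpace ℝ X]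

theorem PC.shift {σ : ℝ → Q} (hσ : σ ∈ PC Q) {c : ℝ} (hc : 0 ≤ c) :
    (fun t => σ (t + c)) ∈ PC Q := by
  obtain ⟨τ, hτ0, hτm, hτt, hτ⟩ := hσ
  obtain ⟨j, hj⟩ := IsSamplingSequence.exists_mem_Ico ⟨hτ0, hτm, hτt⟩ hc
  -- Since `τ j ≤ c < τ (j + 1)`, the first new switching time is `0` instead of the possibly
  -- negative `τ j - c`.
  refine ⟨fun i => if i = 0 then 0 else τ (j + i) - c, by simp, ?_, ?_, ?_⟩
  · refine strictMono_nat_of_lt_succ fun i => ?_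
    rcases Nat.eq_zero_or_pos i with rfl | hi
    · simpa using hj.2
    · simp only [hi.ne', if_false, Nat.succ_ne_zero]
      have := hτm (show j + i < j + (i + 1) by omega)
      linarith
  · have h1 : Tendsto (fun i => τ (j + i) - c) atTop atTop :=
      tendsto_atTop_add_const_right _ _ (hτt.comp (tendsto_add_atTop_nat j |>.congr
        fun i => add_comm i j))
    refine h1.congr' ?_
    filter_upwards [eventually_gt_atTop 0] with i hi
    simp [hi.ne']
  · intro i u hu
    rcases Nat.eq_zero_or_pos i with rfl | hi
    · simp only [zero_add, if_true, one_ne_zero, if_false, mem_Ico] at hu ⊢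
      rw [hτ j (u + c) ⟨by linarith [hj.1], by linarith⟩, hτ j c hj]
    · simp only [hi.ne', if_false, Nat.succ_ne_zero, mem_Ico] at hu ⊢
      rw [hτ (j + i) (u + c) ⟨by linarith, by rw [add_assoc]; linarith⟩, sub_add_cancel]

theorem IsSamplingSequence.shift {s : ℕ → ℝ} (hs : IsSamplingSequence s) (k : ℕ) :
    IsSamplingSequence fun j => s (j + k) - s k := by
  refine ⟨by simp, fun i j h => ?_, ?_⟩
  · have := hs.strictMono (show i + k < j + k by omega)
    simpa using this
  · exact tendsto_atTop_add_const_right _ _ (hs.tendsto.comp (tendsto_add_atTop_nat k))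

/-- The restart is made at a sampling instant because the feedback between samples depends on the
last sampled state. -/
theorem IsSampledTrajectory.shift {T : C0Group X} {f : Q → X × U → X} {K : X → U} {s : ℕ → ℝ}
    (hs : IsSamplingSequence s) {x₀ : X} {σ : ℝ → Q} {x : ℝ → X}
    (hx : IsSampledTrajectory T f K s x₀ σ x) (k : ℕ) :
    IsSampledTrajectory T f K (fun j => s (j + k) - s k) (x (s k)) (fun t => σ (t + s k))
      (fun t => x (t + s k)) := by
  obtain ⟨hc, -, hm⟩ := hx
  refine ⟨hc.comp (by fun_prop) fun t ht => ?_, by simp, fun j t ht => ?_⟩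
  · exact add_nonneg ht (hs.nonneg k)
  · have h := hm (j + k) (t + s k) ⟨by linarith [ht.1], by
      have : t < s (j + 1 + k) - s k := ht.2
      rw [show j + 1 + k = j + k + 1 by omega] at this
      linarith⟩
    simp only [sub_add_cancel]
    rw [h, show t + s k - s (j + k) = t - (s (j + k) - s k) by ring]
    congr 1
    refine intervalIntegral.integral_congr fun r _ => ?_
    simp only
    rw [show s (j + k) - s k + r + s k = s (j + k) + r by ring,
      show s (j + k) - s k + r - (s (j + k) - s k) = s (j + k) + r - s (j + k) by ring]

end Shift

/-! ### Comparison of sampled and closed-loop trajectories. -/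

section Comparison

variable {X : Type*} [NormedAddCommGroup X] [NormedSpace ℝ X] [CompleteSpace X]

/-- Stability of Volterra solutions in the weighted norm: the right-hand sides `G x` and `G' y`
are compared along the solutions. -/
theorem norm_volterra_sub_le {T : C0Group X} {C w L : ℝ} (hC : 0 < C) (hL : 0 < L)
    (hT : ∀ t : ℝ, 0 ≤ t → ‖T t‖ ≤ C * Real.exp (w * t))
    {G G' : ℝ → (ℝ → X) → X} {L₁ L₂ : ℝ} (hG : IsCausalLipschitz G L₁)
    (hG' : IsCausalLipschitz G' L₂) {x₀ y₀ : X} {x y : ℝ → X}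
    (hx : ContinuousOn x (Ici 0)) (hxV : IsVolterraSolution T (fun r => G r x) x₀ x)
    (hy : ContinuousOn y (Ici 0)) (hyV : IsVolterraSolution T (fun r => G' r y) y₀ y)
    {e : ℝ} (he : 0 ≤ e)
    (hGG : ∀ D s : ℝ, 0 ≤ D → 0 ≤ s →
      (∀ r ∈ Icc 0 s, ‖x r - y r‖ ≤ D * Real.exp ((w + 2 * (C * L)) * r)) →
      ‖G s x - G' s y‖ ≤ L * (D + e) * Real.exp ((w + 2 * (C * L)) * s))
    {t : ℝ} (ht : 0 ≤ t) :
    ‖x t - y t‖ ≤ (2 * C * ‖x₀ - y₀‖ + e) * Real.exp ((w + 2 * (C * L)) * t) := by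
  have hCL : 0 < C * L := mul_pos hC hL
  set lam := w + 2 * (C * L) with hlam
  have hlw : w < lam := by linarith
  have hhalf : ∀ E : ℝ, C * (L * E) / (lam - w) = E / 2 := by
    intro E
    rw [hlam]
    field_simp
    ring
  -- A bound `D` on the weighted difference improves to `C * ‖x₀ - y₀‖ + (D + e) / 2`.
  have h := norm_le_of_weighted_improvement (u := fun t => x t - y t) (lam := lam)
    (e := C * ‖x₀ - y₀‖ + e / 2) (N := t)
    ((hx.sub hy).mono Icc_subset_Ici_self) ?_ t ⟨ht, le_rfl⟩
  · refine h.trans_eq ?_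
    ring
  intro D hD hxy r hr
  rw [hxV r hr.1, hyV r hr.1, hG.volterra_sub hG' hx hy hr.1]
  have h1 : ‖T r (x₀ - y₀)‖ ≤ C * ‖x₀ - y₀‖ * Real.exp (lam * r) := by
    refine ((T r).le_of_opNorm_le (hT r hr.1) _).trans ?_
    rw [mul_right_comm]
    gcongr
    exact hr.1
  have h2 := T.norm_duhamel_le (h := fun r => G r x - G' r y) hT hC.le hlw hr.1
    (E := L * (D + e)) (by positivity) fun s hs =>
      hGG D s hD hs.1 fun q hq => hxy q ⟨hq.1, hq.2.trans (hs.2.trans hr.2)⟩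
  rw [hhalf] at h2
  refine (norm_add_le _ _).trans ((add_le_add h1 h2).trans_eq ?_)
  ring

/-- Equal initial values give uniqueness; comparison with the zero solution gives an a priori growth
bound. -/
theorem IsCausalLipschitz.norm_volterra_sub_le {T : C0Group X} {C w L : ℝ} (hC : 0 < C)
    (hw : 0 ≤ w) (hL : 0 < L) (hT : ∀ t : ℝ, 0 ≤ t → ‖T t‖ ≤ C * Real.exp (w * t))
    {G : ℝ → (ℝ → X) → X} (hG : IsCausalLipschitz G L) {x₀ y₀ : X} {x y : ℝ → X}
    (hx : ContinuousOn x (Ici 0)) (hxV : IsVolterraSolution T (fun r => G r x) x₀ x)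
    (hy : ContinuousOn y (Ici 0)) (hyV : IsVolterraSolution T (fun r => G r y) y₀ y)
    {t : ℝ} (ht : 0 ≤ t) :
    ‖x t - y t‖ ≤ 2 * C * ‖x₀ - y₀‖ * Real.exp ((w + 2 * (C * L)) * t) := by
  have hCL : 0 < C * L := mul_pos hC hL
  have h := _root_.norm_volterra_sub_le hC hL hT hG hG hx hxV hy hyV (e := 0) le_rfl
    (fun D s hD hs h => by
      rw [add_zero]
      exact hG.lip_exp (by linarith) hD hs h) ht
  simpa using h

variable {U Q : Type*} [NormedAddCommGroup U]

/-- Over one run, the sampled trajectory stays close to the closed-loop trajectory, with an error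
proportional to the maximal lag `d`. -/
theorem exists_norm_predictor_sub_le (T : C0Group X)
    (f : Q → X × U → X) (Lf : ℝ≥0) (hf : ∀ q, LipschitzWith Lf (f q))
    (hf0 : ∀ q, f q (0, 0) = 0)
    (K : X → U) (LK : ℝ≥0) (hK : LipschitzWith LK K) (hK0 : K 0 = 0) :
    ∃ L P lam : ℝ, 0 < L ∧ 0 < P ∧ 0 < lam ∧
      (∀ σ ∈ PC Q, ∀ s : ℕ → ℝ, IsSamplingSequence s → ∀ (l : ℝ → ℝ) (d : ℝ), d ≤ 1 →
        IsLag s d l → IsCausalLipschitz (predictorField T f K σ l) L) ∧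
      ∀ σ ∈ PC Q, ∀ s : ℕ → ℝ, IsSamplingSequence s → ∀ (l : ℝ → ℝ) (d : ℝ), 0 ≤ d → d ≤ 1 →
        IsLag s d l → ∀ (x₀ : X) (x z : ℝ → X),
        ContinuousOn x (Ici 0) →
        IsVolterraSolution T (fun r => predictorField T f K σ l r x) x₀ x →
        ContinuousOn z (Ici 0) →
        IsVolterraSolution T (fun r => predictorField T f K σ id r z) x₀ z →
        ∀ t : ℝ, 0 ≤ t → ‖x t - z t‖ ≤ d * P * ‖x₀‖ * Real.exp (lam * t) := by
  obtain ⟨C, w, hC1, hw, hT⟩ := T.exists_norm_le_exp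
  obtain ⟨C', hC'0, hC'⟩ := T.exists_norm_le_on_Icc 0 1
  have hC : 0 < C := by linarith
  -- `B ≥ 1` lets the same `L` serve when both arguments are compared directly with `z r`, where the
  -- factor is `1 + LK`.
  set B := C' + 1
  have hB1 : 1 ≤ B := by simp only [B]; linarith
  have hB : ∀ t ∈ Icc (0 : ℝ) 1, ‖T t‖ ≤ B := fun t ht => (hC' t ht).trans (by simp [B])
  -- The summand `1` keeps `L` positive when `Lf = 0`.
  set L : ℝ := Lf * (1 + LK * B) + 1 with hLdef
  have hL : 0 < L := by positivity
  have hCL : 0 < C * L := mul_pos hC hL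
  have hfL : Lf * (1 + LK * B) ≤ L := by linarith
  have hLip : ∀ σ ∈ PC Q, ∀ s : ℕ → ℝ, IsSamplingSequence s → ∀ (l : ℝ → ℝ) (d : ℝ), d ≤ 1 →
      IsLag s d l → IsCausalLipschitz (predictorField T f K σ l) L :=
    fun σ hσ s hs l d hd hl => isCausalLipschitz_predictorField hf hf0 hK hK0 hσ hs hl
      (fun t ht => hB t ⟨ht.1, ht.2.trans hd⟩) hfL
  set lam := w + 2 * (C * L) with hlam
  have hlam0 : 0 < lam := by linarith
  refine ⟨L, B * L * (2 * C), lam, hL, by positivity, hlam0, hLip, ?_⟩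
  intro σ hσ s hs l d hd0 hd hl x₀ x z hx hxV hz hzV t ht
  have hG := hLip σ hσ s hs l d hd hl
  have hG' := hLip σ hσ s hs id d hd (isLag_id s hd0)
  have hzeroV : IsVolterraSolution T (fun r => predictorField T f K σ l r (fun _ => 0)) 0
      (fun _ => 0) := by
    intro t ht
    have h0 : ∫ r in (0 : ℝ)..t, T (-r) (predictorField T f K σ l r (fun _ => 0)) =
        ∫ r in (0 : ℝ)..t, 0 := by
      refine intervalIntegral.integral_congr fun r hr => ?_
      rw [uIcc_of_le ht] at hr
      simp only [hG.zero r hr.1, map_zero]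
    rw [h0]
    simp
  have hapriori : ∀ t : ℝ, 0 ≤ t → ‖x t‖ ≤ 2 * C * ‖x₀‖ * Real.exp (lam * t) := fun t ht => by
    simpa using hG.norm_volterra_sub_le hC hw hL hT hx hxV continuousOn_const hzeroV ht
  -- The predictor misses only the forcing on `[l r, r]`: an interval of length at most `d`, with an
  -- integrand controlled by the a priori bound.
  have hgap : ∀ r : ℝ, 0 ≤ r → ‖T (r - l r) (x (l r)) - x r‖ ≤
      d * (B * L * (2 * C)) * ‖x₀‖ * Real.exp (lam * r) := by
    intro r hr
    have hl0 := hl.nonneg r hr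
    have hle := hl.le r hr
    have h1 : x r = T (r - l r) (x (l r)) +
        ∫ q in (l r)..r, T r (T (-q) (predictorField T f K σ l q x)) := by
      rw [hxV r hr, ← intervalIntegral.integral_add_adjacent_intervals
        (hG.intervalIntegrable T hx hl0) ((hG.intervalIntegrable T hx hl0).symm.trans
          (hG.intervalIntegrable T hx hr)), ← add_assoc, (T r).map_add, hxV _ hl0,
        T.apply_apply (r - l r), sub_add_cancel, T.apply_intervalIntegral r (l r) r]
    have h2 : ‖∫ q in (l r)..r, T r (T (-q) (predictorField T f K σ l q x))‖ ≤
        B * (L * (2 * C * ‖x₀‖ * Real.exp (lam * r))) * |r - l r| := by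
      refine intervalIntegral.norm_integral_le_of_norm_le_const fun q hq => ?_
      rw [uIoc_of_le hle] at hq
      have hq0 : 0 ≤ q := hl0.trans hq.1.le
      rw [T.apply_apply]
      refine (T _).le_of_opNorm_le_of_le (hB _ ⟨by linarith [hq.2], ?_⟩) (hG.norm_le hq0 ?_)
      · linarith [hl.lag r hr, hq.1]
      · intro p hp
        refine (hapriori p hp.1).trans ?_
        gcongr
        exact hp.2.trans hq.2
    rw [norm_sub_rev, sub_eq_iff_eq_add'.2 h1]
    refine h2.trans ?_
    rw [abs_of_nonneg (sub_nonneg.2 hle)]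
    calc B * (L * (2 * C * ‖x₀‖ * Real.exp (lam * r))) * (r - l r)
        ≤ B * (L * (2 * C * ‖x₀‖ * Real.exp (lam * r))) * d := by
          gcongr
          exact hl.lag r hr
      _ = _ := by ring
  have hcmp := norm_volterra_sub_le hC hL hT hG hG' hx hxV hz hzV
    (e := d * (B * L * (2 * C)) * ‖x₀‖) (by positivity) ?_ ht
  · simpa using hcmp
  intro D r hD hr h
  have h1 := h r ⟨hr, le_rfl⟩
  rw [predictorField_id]
  have h2 : ‖T (r - l r) (x (l r)) - z r‖ ≤
      (D + d * (B * L * (2 * C)) * ‖x₀‖) * Real.exp (lam * r) := by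
    rw [← sub_add_sub_cancel _ (x r), add_comm D, add_mul]
    exact (norm_add_le _ _).trans (add_le_add (hgap r hr) h1)
  have h3 : ‖x r - z r‖ ≤ (D + d * (B * L * (2 * C)) * ‖x₀‖) * Real.exp (lam * r) := by
    refine h1.trans ?_
    gcongr
    have : 0 ≤ d * (B * L * (2 * C)) * ‖x₀‖ := by positivity
    linarith
  refine (norm_field_sub_le hf hK (σ r) h3 h2).trans ?_
  set E := (D + d * (B * L * (2 * C)) * ‖x₀‖) * Real.exp (lam * r)
  have hE : 0 ≤ E := (norm_nonneg _).trans h3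
  calc Lf * (E + LK * E) = Lf * (1 + LK * 1) * E := by ring
    _ ≤ Lf * (1 + LK * B) * E := by gcongr
    _ ≤ L * E := by gcongr
    _ = _ := by rw [mul_assoc]

end Comparison

/-! ### From finite-time closeness to exponential stability. -/

theorem IsSamplingSequence.exists_mem_Icc {s : ℕ → ℝ} (hs : IsSamplingSequence s) {d a : ℝ}
    (hd : ∀ k, s (k + 1) - s k ≤ d) (ha : 0 ≤ a) : ∃ k, s k ∈ Icc a (a + d) := by
  obtain ⟨k, hk⟩ := hs.exists_mem_Ico ha
  exact ⟨k + 1, hk.2.le, by linarith [hd k, hk.1]⟩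

/-- Halving the norm at some sampling instant of every time window `[a, a + 1]`, together with
boundedness on `[0, a + 1]`, gives uniform exponential stability. -/
theorem uges_of_halving {X U Q : Type*} [NormedAddCommGroup X] [NormedSpace ℝ X]
    {T : C0Group X} {f : Q → X × U → X} {K : X → U} {d a B : ℝ} (hd : d ≤ 1) (ha : 0 < a)
    (hB : 0 < B)
    (hbound : ∀ s : ℕ → ℝ, IsSamplingSequence s → (∀ k, s (k + 1) - s k ≤ d) →
      ∀ x₀ : X, ∀ σ ∈ PC Q, ∀ x : ℝ → X, IsSampledTrajectory T f K s x₀ σ x →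
        (∀ t ∈ Icc 0 (a + 1), ‖x t‖ ≤ B * ‖x₀‖) ∧
        ∀ t ∈ Icc a (a + 1), ‖x t‖ ≤ 1 / 2 * ‖x₀‖)
    {s : ℕ → ℝ} (hs : IsSamplingSequence s) (hsd : ∀ k, s (k + 1) - s k ≤ d) :
    UGES (PC Q) (IsSampledTrajectory T f K s) := by
  -- Restarts come at most `a + 1` apart, so halving at each gives this rate: `exp (-mu * (a + 1)) =
  -- 1 / 2`.
  set mu := Real.log 2 / (a + 1)
  have hmu : 0 < mu := div_pos (Real.log_pos one_lt_two) (by linarith)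
  have hexp : ∀ t ≤ a + 1, 1 / 2 ≤ Real.exp (-mu * t) := by
    intro t ht
    have h1 : Real.exp (-Real.log 2) = 1 / 2 := by
      rw [Real.exp_neg, Real.exp_log two_pos, one_div]
    rw [← h1]
    apply Real.exp_le_exp.2
    have h2 : mu * t ≤ mu * (a + 1) := by gcongr
    have h3 : mu * (a + 1) = Real.log 2 := div_mul_cancel₀ _ (by linarith)
    linarith
  -- The induction ranges over all sampling sequences, signals and initial states, since a restart
  -- changes each of them. Every restart uses up at least time `a`, whence the horizon `n * a`.
  have key : ∀ n : ℕ, ∀ s : ℕ → ℝ, IsSamplingSequence s → (∀ k, s (k + 1) - s k ≤ d) →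
      ∀ x₀ : X, ∀ σ ∈ PC Q, ∀ x : ℝ → X, IsSampledTrajectory T f K s x₀ σ x →
        ∀ t : ℝ, 0 ≤ t → t ≤ n * a → ‖x t‖ ≤ 2 * B * Real.exp (-mu * t) * ‖x₀‖ := by
    intro n
    induction n with
    | zero =>
      intro s hs hsd x₀ σ hσ x hx t ht0 ht
      have hta : t ≤ a + 1 := by simp at ht; linarith
      refine ((hbound s hs hsd x₀ σ hσ x hx).1 t ⟨ht0, hta⟩).trans ?_
      have := hexp t hta
      gcongr
      nlinarith
    | succ n ih =>
      intro s hs hsd x₀ σ hσ x hx t ht0 ht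
      obtain ⟨hb1, hb2⟩ := hbound s hs hsd x₀ σ hσ x hx
      by_cases hta : t ≤ a + 1
      · refine (hb1 t ⟨ht0, hta⟩).trans ?_
        have := hexp t hta
        gcongr
        nlinarith
      · obtain ⟨k, hk⟩ := hs.exists_mem_Icc hsd ha.le
        have hk1 : s k ≤ a + 1 := hk.2.trans (by linarith)
        push_cast at ht
        have h := ih _ (hs.shift k) (fun j => by
            have := hsd (j + k)
            rw [show j + k + 1 = j + 1 + k by omega] at this
            linarith) (x (s k)) _ (PC.shift hσ (hs.nonneg k)) _ (hx.shift hs k) (t - s k)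
          (by linarith) (by linarith [hk.1])
        simp only [sub_add_cancel] at h
        refine h.trans ?_
        have h1 : ‖x (s k)‖ ≤ Real.exp (-mu * s k) * ‖x₀‖ :=
          (hb2 (s k) ⟨hk.1, hk1⟩).trans (by
            gcongr
            exact hexp _ hk1)
        calc 2 * B * Real.exp (-mu * (t - s k)) * ‖x (s k)‖
            ≤ 2 * B * Real.exp (-mu * (t - s k)) * (Real.exp (-mu * s k) * ‖x₀‖) := by gcongr
          _ = 2 * B * (Real.exp (-mu * (t - s k)) * Real.exp (-mu * s k)) * ‖x₀‖ := by ring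
          _ = _ := by rw [← Real.exp_add]; ring_nf
  refine ⟨2 * B, by linarith, mu, hmu, fun x₀ σ hσ x hx t ht => ?_⟩
  refine key ⌈t / a⌉₊ s hs hsd x₀ σ hσ x hx t ht ?_
  exact (div_le_iff₀ ha).1 (Nat.le_ceil _)

theorem sub_le_of_maxSamplingTime_lt {s : ℕ → ℝ} {d : ℝ} (hd : 0 ≤ d)
    (h : maxSamplingTime s < ENNReal.ofReal d) (k : ℕ) : s (k + 1) - s k ≤ d :=
  (ENNReal.ofReal_le_ofReal_iff hd).1
    ((le_iSup (fun k => ENNReal.ofReal (s (k + 1) - s k)) k).trans h.le)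

theorem mainTheorem8 {X U Q : Type*}
    [NormedAddCommGroup X] [NormedSpace ℝ X] [CompleteSpace X]
    [NormedAddCommGroup U] [NormedSpace ℝ U] [CompleteSpace U]
    (T : C0Group X)
    (f : Q → X × U → X) (Lf : ℝ≥0) (hf : ∀ q, LipschitzWith Lf (f q))
    (hf0 : ∀ q, f q (0, 0) = 0)
    (K : X → U) (LK : ℝ≥0) (hK : LipschitzWith LK K) (hK0 : K 0 = 0)
    (hUGES : UGES (PC Q) (IsClosedLoopTrajectory T f K)) :
    ∃ δstar : ℝ, 0 < δstar ∧
      ∀ s : ℕ → ℝ, IsSamplingSequence s → maxSamplingTime s < ENNReal.ofReal δstar →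
        WellPosed (PC Q) (IsSampledTrajectory T f K s) ∧
          UGES (PC Q) (IsSampledTrajectory T f K s) := by
  obtain ⟨M, hM, lam₀, hlam₀, hdecay⟩ := hUGES
  obtain ⟨L, P, lam, hL, hP, hlam, hLip, hclose⟩ :=
    exists_norm_predictor_sub_le T f Lf hf hf0 K LK hK hK0
  obtain ⟨C, w, hC1, hw, hT⟩ := T.exists_norm_le_exp
  obtain ⟨a, ha0, ha⟩ : ∃ a : ℝ, 0 < a ∧ ∀ t, a ≤ t → M * Real.exp (-lam₀ * t) ≤ 1 / 4 := by
    have h1 : Tendsto (fun t : ℝ => M * Real.exp (-lam₀ * t)) atTop (𝓝 (M * 0)) :=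
      (Real.tendsto_exp_atBot.comp
        (tendsto_id.const_mul_atTop_of_neg (neg_lt_zero.2 hlam₀))).const_mul M
    rw [mul_zero] at h1
    obtain ⟨a, ha⟩ := eventually_atTop.1 (h1.eventually_le_const (by norm_num : (0 : ℝ) < 1 / 4))
    exact ⟨max a 1, by positivity, fun t ht => ha t ((le_max_left _ _).trans ht)⟩
  -- On `[0, a + 1]` the comparison error is at most `d * R * ‖x₀‖`, so `d ≤ 1 / (4 * R)` makes it
  -- at most `‖x₀‖ / 4`.
  set R := P * Real.exp (lam * (a + 1))
  have hR : 0 < R := by positivity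
  set d := min 1 (1 / (4 * R))
  have hd0 : 0 < d := by positivity
  have hd1 : d ≤ 1 := min_le_left _ _
  have hdR : d * R ≤ 1 / 4 := by
    calc d * R ≤ 1 / (4 * R) * R := by gcongr; exact min_le_right _ _
      _ = 1 / 4 := by field_simp
  refine ⟨d, hd0, fun s hs hsmax => ?_⟩
  have hsd := sub_le_of_maxSamplingTime_lt hd0.le hsmax
  constructor
  · intro x₀ σ hσ
    have hG := hLip σ hσ s hs _ d hd1 (isLag_lastSample hs hsd)
    obtain ⟨x, hx, hxV⟩ := hG.exists_volterra hL T x₀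
    refine ⟨x, (isSampledTrajectory_iff hs hG).2 ⟨hx, hxV⟩, fun y hy t ht => ?_⟩
    obtain ⟨hyc, hyV⟩ := (isSampledTrajectory_iff hs hG).1 hy
    have h := hG.norm_volterra_sub_le (by linarith) hw hL hT hyc hyV hx hxV ht
    rw [sub_self, norm_zero, mul_zero, zero_mul] at h
    exact sub_eq_zero.1 (norm_le_zero_iff.1 h)
  · refine uges_of_halving (a := a) (B := M + 1 / 4) hd1 ha0 (by linarith) ?_ hs hsd
    intro s hs hsd x₀ σ hσ x hx
    have hl := isLag_lastSample hs hsd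
    have hG' := hLip σ hσ s hs id d hd1 (isLag_id s hd0.le)
    obtain ⟨hxc, hxV⟩ := (isSampledTrajectory_iff hs (hLip σ hσ s hs _ d hd1 hl)).1 hx
    -- The comparison trajectory solves the closed loop with the same initial state and signal.
    obtain ⟨z, hz, hzV⟩ := hG'.exists_volterra hL T x₀
    have hzb := hdecay x₀ σ hσ z (isClosedLoopTrajectory_of_volterra hG' hz hzV)
    have hmain : ∀ t ∈ Icc 0 (a + 1), ‖x t‖ ≤ (M * Real.exp (-lam₀ * t) + 1 / 4) * ‖x₀‖ := by
      intro t ht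
      have h1 := hclose σ hσ s hs _ d hd0.le hd1 hl x₀ x z hxc hxV hz hzV t ht.1
      have h2 : d * P * ‖x₀‖ * Real.exp (lam * t) ≤ 1 / 4 * ‖x₀‖ :=
        calc d * P * ‖x₀‖ * Real.exp (lam * t)
            ≤ d * P * ‖x₀‖ * Real.exp (lam * (a + 1)) := by gcongr; exact ht.2
          _ = d * R * ‖x₀‖ := by ring
          _ ≤ _ := by gcongr
      rw [add_mul]
      calc ‖x t‖ = ‖z t + (x t - z t)‖ := by rw [add_sub_cancel]
        _ ≤ ‖z t‖ + ‖x t - z t‖ := norm_add_le _ _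
        _ ≤ _ := add_le_add (hzb t ht.1) (h1.trans h2)
    refine ⟨fun t ht => (hmain t ht).trans ?_, fun t ht =>
      (hmain t ⟨ha0.le.trans ht.1, ht.2⟩).trans ?_⟩
    · gcongr
      refine mul_le_of_le_one_right hM.le (Real.exp_le_one_iff.2 ?_)
      have := mul_nonneg hlam₀.le ht.1
      linarith
    · gcongr
      linarith [ha t ht.1]
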